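/- Work on $(0,\infty)$ with Lebesgue measure $|\cdot|$. For a measurable $f$ let $f^*(t)=\inf\{\lambda\ge 0: |\{|f|>\lambda\}|\le t\}$, $t\ge 0$, be its decreasing rearrangement. A function $\varphi:(0,\infty)\to(0,\infty)$ is quasi-concave if it is (weakly) increasing and $\varphi(t)/t$ is (weakly) decreasing; put $\varphi(0)=0$ and $$\Lambda_\varphi=\Big\{f:\ \|f\|_{\Lambda_\varphi}=\int_{[0,\infty)} f^*\,d\varphi<\infty\Big\},$$ where $d\varphi$ is the Lebesgue–Stieltjes measure (with mass $\varphi(0+)$ at $0$). An r.i. Banach space is a rearrangement invariant Banach function space on $(0,\infty)$ in the sense of Bennett and Sharpley (in particular with the Fatou property). If $X$ is an r.i. Banach space containing the function $s\mapsto 1/(1+s)$, then $W_X(t)=\big\|\frac{1}{1+\cdot/t}\big\|_X$ is quasi-concave, and one sets $R(X)=\Lambda_{W_X}$. Let $Sf(t)=\frac1t\int_0^t f(r)\,dr$ be the Hardy operator, and let $\mathfrak{R}[S,\Lambda_\varphi]$ denote the minimal r.i. Banach space $Y$ such that $S:\Lambda_\varphi\to Y$ is bounded, that is, $S:\Lambda_\varphi\to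 Y$ is bounded and $Y\subset Z$ for every r.i. Banach space $Z$ such that $S:\Lambda_\varphi\to Z$ is bounded. Let $\varphi$ be a quasi-concave function for which there is a constant $C>0$ with $\varphi(t)\ge C\,t\log(1+1/t)$ for all $t>0$. Then $\mathfrak{R}[S,\Lambda_\varphi]$ exists, and if there is an r.i. Banach space $X$ (containing $1/(1+s)$) with $R(X)=\Lambda_\varphi$, then $\mathfrak{R}[S,\Lambda_\varphi]$ contains $1/(1+s)$ and $R(\mathfrak{R}[S,\Lambda_\varphi])=\Lambda_\varphi$. Consequently, the equation $R(X)=\Lambda_\varphi$ has a solution $X$ among the r.i. Banach spaces if and only if $X=\mathfrak{R}[S,\Lambda_\varphi]$ is a solution. -/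

import Mathlib

open MeasureTheory Set
open scoped ENNReal NNReal

noncomputable section

namespace RestrictedType

/-- Lebesgue measure on the half-line `(0, ∞)`. Functions on `(0, ∞)` are represented by functions
on `ℝ`, whose values outside `(0, ∞)` play no role. -/
def halfLine : Measure ℝ := volume.restrict (Ioi 0)

/-- The distribution function `λ ↦ |{x > 0 : f x > λ}|` of a nonnegative function. -/
def distribution (f : ℝ → ℝ≥0∞) (l : ℝ≥0∞) : ℝ≥0∞ := halfLine {x | l < f x}

/-- The decreasing rearrangement `f^*(t) = inf {λ ≥ 0 : |{|f| > λ}| ≤ t}` for `t ≥ 0`;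
in particular `f^*(0)` is the essential supremum of `|f|`. -/
def rearrangement (f : ℝ → ℝ) (t : ℝ) : ℝ≥0∞ :=
  sInf {l : ℝ≥0∞ | distribution (fun x => ‖f x‖ₑ) l ≤ ENNReal.ofReal t}

/-- Quasi-concave functions on `(0, ∞)` (only the values at `t > 0` matter). -/
structure QuasiConcave (φ : ℝ → ℝ) : Prop where
  pos : ∀ t, 0 < t → 0 < φ t
  mono : ∀ s t, 0 < s → s ≤ t → φ s ≤ φ t
  div_anti : ∀ s t, 0 < s → s ≤ t → φ t / t ≤ φ s / s

theorem QuasiConcave.monotone_extend {φ : ℝ → ℝ} (hφ : QuasiConcave φ) :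
    Monotone (fun t : ℝ => if t ≤ 0 then 0 else φ t) := by
  intro s t hst
  dsimp only
  split_ifs with hs ht ht
  · exact le_rfl
  · exact (hφ.pos t (not_le.mp ht)).le
  · exact absurd (hst.trans ht) hs
  · exact hφ.mono s t (not_le.mp hs) hst

/-- The Lebesgue–Stieltjes measure `dφ` on `[0, ∞)`, where `φ` is normalized by `φ(0) = 0`;
it has an atom of mass `φ(0+)` at `0`. -/
def QuasiConcave.measure {φ : ℝ → ℝ} (hφ : QuasiConcave φ) : Measure ℝ :=
  hφ.monotone_extend.stieltjesFunction.measure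

/-- `‖f‖_{Λ_φ} = ∫_{[0,∞)} f^* dφ`. -/
def lorentzNorm {φ : ℝ → ℝ} (hφ : QuasiConcave φ) (f : ℝ → ℝ) : ℝ≥0∞ :=
  ∫⁻ t, rearrangement f t ∂hφ.measure

/-- The minimal Lorentz space `Λ_φ`. -/
def lorentzSpace {φ : ℝ → ℝ} (hφ : QuasiConcave φ) : Set (ℝ → ℝ) :=
  {f | AEMeasurable f halfLine ∧ lorentzNorm hφ f < ∞}

/-- A rearrangement invariant Banach function space on `(0, ∞)`, given by its function norm `ρ`
on nonnegative measurable functions (in the sense of Bennett and Sharpley). -/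
structure RISpace where
  ρ : (ℝ → ℝ≥0∞) → ℝ≥0∞
  eq_zero_iff : ∀ f, AEMeasurable f halfLine → (ρ f = 0 ↔ f =ᵐ[halfLine] 0)
  smul : ∀ (a : ℝ≥0) (f), AEMeasurable f halfLine → ρ (fun x => (a : ℝ≥0∞) * f x) = a * ρ f
  add_le : ∀ f g, AEMeasurable f halfLine → AEMeasurable g halfLine →
    ρ (fun x => f x + g x) ≤ ρ f + ρ g
  mono : ∀ f g, AEMeasurable f halfLine → AEMeasurable g halfLine →
    (∀ᵐ x ∂halfLine, f x ≤ g x) → ρ f ≤ ρ g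
  fatou : ∀ f : ℕ → ℝ → ℝ≥0∞, (∀ n, AEMeasurable (f n) halfLine) →
    (∀ᵐ x ∂halfLine, Monotone (fun n => f n x)) → ρ (fun x => ⨆ n, f n x) = ⨆ n, ρ (f n)
  indicator_lt_top : ∀ E : Set ℝ, MeasurableSet E → halfLine E < ∞ →
    ρ (E.indicator (fun _ => 1)) < ∞
  setLIntegral_le : ∀ E : Set ℝ, MeasurableSet E → halfLine E < ∞ →
    ∃ C : ℝ≥0, ∀ f, AEMeasurable f halfLine → ∫⁻ x in E, f x ∂halfLine ≤ C * ρ f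
  rearrangement_invariant : ∀ f g, AEMeasurable f halfLine → AEMeasurable g halfLine →
    (∀ l, distribution f l = distribution g l) → ρ f = ρ g

namespace RISpace

/-- `‖f‖_X = ρ(|f|)`. -/
def norm (X : RISpace) (f : ℝ → ℝ) : ℝ≥0∞ := X.ρ (fun x => ‖f x‖ₑ)

/-- The elements of the space `X`. -/
def carrier (X : RISpace) : Set (ℝ → ℝ) := {f | AEMeasurable f halfLine ∧ X.norm f < ∞}

/-- `W_X(t) = ‖1 / (1 + · / t)‖_X`. -/
def W (X : RISpace) (t : ℝ) : ℝ := (X.norm (fun s => 1 / (1 + s / t))).toReal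

theorem measurable_kernel (t : ℝ) : Measurable (fun s : ℝ => 1 / (1 + s / t)) := by fun_prop

theorem norm_le_mul (X : RISpace) {f g : ℝ → ℝ} (hf : Measurable f) (hg : Measurable g) (a : ℝ≥0)
    (h : ∀ x, 0 < x → |f x| ≤ a * |g x|) : X.norm f ≤ a * X.norm g := by
  have hg' : AEMeasurable (fun x => ‖g x‖ₑ) halfLine := hg.enorm.aemeasurable
  rw [norm, norm, ← X.smul a _ hg']
  refine X.mono _ _ hf.enorm.aemeasurable (hg'.const_mul _) ?_
  refine (ae_restrict_iff' measurableSet_Ioi).2 (Filter.Eventually.of_forall fun x hx => ?_)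
  have := h x hx
  rw [← ofReal_norm, ← ofReal_norm, ← ENNReal.ofReal_coe_nnreal,
    ← ENNReal.ofReal_mul a.coe_nonneg]
  exact ENNReal.ofReal_le_ofReal this

theorem norm_kernel_lt_top (X : RISpace) (hX : (fun s : ℝ => 1 / (1 + s)) ∈ X.carrier) {t : ℝ}
    (ht : 0 < t) : X.norm (fun s => 1 / (1 + s / t)) < ∞ := by
  refine (X.norm_le_mul (measurable_kernel t) (g := fun s => 1 / (1 + s)) (by fun_prop)
    (Real.toNNReal (max 1 t)) fun s hs => ?_).trans_lt (ENNReal.mul_lt_top (by simp) hX.2)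
  rw [Real.coe_toNNReal _ (by positivity), abs_of_pos (by positivity), abs_of_pos (by positivity),
    mul_one_div, div_le_div_iff₀ (by positivity) (by positivity)]
  have h1 : (1 : ℝ) ≤ max 1 t := le_max_left _ _
  have h2 : s ≤ max 1 t * (s / t) := by
    calc s = t * (s / t) := by field_simp
      _ ≤ _ := by gcongr; exact le_max_right _ _
  nlinarith

theorem norm_kernel_pos (X : RISpace) {t : ℝ} (ht : 0 < t) :
    0 < X.norm (fun s => 1 / (1 + s / t)) := by
  rw [pos_iff_ne_zero, norm, Ne, X.eq_zero_iff _ (measurable_kernel t).enorm.aemeasurable]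
  intro h
  have h' : ∀ᵐ x ∂halfLine, False := by
    have hmem : ∀ᵐ x ∂halfLine, x ∈ Ioi (0 : ℝ) := ae_restrict_mem measurableSet_Ioi
    filter_upwards [h, hmem] with x hx hx0
    have hx0' : (0 : ℝ) < x := hx0
    have : (0 : ℝ) < 1 / (1 + x / t) := by positivity
    simp only [Pi.zero_apply, enorm_eq_zero] at hx
    exact this.ne' hx
  have h0 : halfLine univ = 0 := by simpa [ae_iff] using h'
  simp [halfLine] at h0

theorem quasiConcave_W (X : RISpace) (hX : (fun s : ℝ => 1 / (1 + s)) ∈ X.carrier) :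
    QuasiConcave X.W where
  pos t ht := ENNReal.toReal_pos (X.norm_kernel_pos ht).ne' (X.norm_kernel_lt_top hX ht).ne
  mono s t hs hst := by
    have ht := hs.trans_le hst
    refine ENNReal.toReal_mono (X.norm_kernel_lt_top hX ht).ne ?_
    have := X.norm_le_mul (measurable_kernel s) (measurable_kernel t) 1 fun x hx => by
      rw [abs_of_pos (by positivity), abs_of_pos (by positivity), NNReal.coe_one, one_mul]
      gcongr
    simpa using this
  div_anti s t hs hst := by
    have ht := hs.trans_le hst
    have h := X.norm_le_mul (measurable_kernel t) (measurable_kernel s) (Real.toNNReal (t / s))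
      fun x hx => by
        rw [abs_of_pos (by positivity), abs_of_pos (by positivity),
          Real.coe_toNNReal _ (by positivity), mul_one_div,
          div_le_div_iff₀ (by positivity) (by positivity)]
        have h1 : (1 : ℝ) ≤ t / s := (one_le_div hs).2 hst
        have h2 : t / s * (x / t) = x / s := by field_simp
        nlinarith
    have h' := ENNReal.toReal_mono
      (ENNReal.mul_ne_top (by simp) (X.norm_kernel_lt_top hX hs).ne) h
    rw [ENNReal.toReal_mul, ENNReal.coe_toReal, Real.coe_toNNReal _ (by positivity)] at h'
    change X.W t ≤ t / s * X.W s at h'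
    rw [div_le_iff₀ ht]
    calc X.W t ≤ t / s * X.W s := h'
      _ = X.W s / s * t := by ring

/-- The space `R(X) = Λ_{W_X}`, defined when `1 / (1 + s)` belongs to `X`. -/
def R (X : RISpace) (hX : (fun s : ℝ => 1 / (1 + s)) ∈ X.carrier) : Set (ℝ → ℝ) :=
  lorentzSpace (X.quasiConcave_W hX)

/-- `X` solves the equation `R(X) = Λ_φ`: the space `R(X)` is defined and has the same elements
as `Λ_φ`. -/
def Solves (X : RISpace) {φ : ℝ → ℝ} (hφ : QuasiConcave φ) : Prop :=
  ∃ hX : (fun s : ℝ => 1 / (1 + s)) ∈ X.carrier, X.R hX = lorentzSpace hφ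

end RISpace

/-- The Hardy operator `S f (t) = (1 / t) ∫_0^t f(r) dr`. -/
def hardy (f : ℝ → ℝ) (t : ℝ) : ℝ := 1 / t * ∫ r in Ioc 0 t, f r

/-- `S : Λ_φ → Y` is bounded. -/
def HardyBounded {φ : ℝ → ℝ} (hφ : QuasiConcave φ) (Y : RISpace) : Prop :=
  ∃ C : ℝ≥0, ∀ f ∈ lorentzSpace hφ, hardy f ∈ Y.carrier ∧ Y.norm (hardy f) ≤ C * lorentzNorm hφ f

/-- `Y` is the minimal r.i. Banach function space such that `S : Λ_φ → Y` is bounded. -/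
def IsOptimalRange {φ : ℝ → ℝ} (hφ : QuasiConcave φ) (Y : RISpace) : Prop :=
  HardyBounded hφ Y ∧ ∀ Z : RISpace, HardyBounded hφ Z → Y.carrier ⊆ Z.carrier

end RestrictedType

end

/-! By dyadic decomposition of a function into indicators, boundedness of `S` on `Λ_φ` is decided by
the functions `S χ_(0,a)`, which are comparable to the kernels `s ↦ 1 / (1 + s / a)`. Hence
`S : Λ_φ → X` is bounded if and only if `‖1 / (1 + · / a)‖_X = O(φ a)`, that is, if and only if
`Λ_φ ⊆ R(X)`.

The logarithmic lower bound on `φ` says exactly that `L¹ + L^∞` has this property, so the supremum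
of all r.i. norms for which `S` is a contraction on `Λ_φ` is taken over a nonempty family, and it is
the norm of the optimal range `N`. If `X` is a solution, then `N ⊆ X` by minimality, so
`Λ_φ ⊆ R(N) ⊆ R(X) = Λ_φ`. -/

namespace RestrictedType

variable {φ ψ : ℝ → ℝ} {f : ℝ → ℝ≥0∞} {E : Set ℝ} {X Y Z : RISpace} {C : ℝ≥0} {a t : ℝ}

/-! ### Nonnegative extended reals -/

theorem ofReal_le_coe_mul_ofReal {x y : ℝ} (hy : 0 ≤ y) :
    ENNReal.ofReal x ≤ C * ENNReal.ofReal y ↔ x ≤ C * y := by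
  rw [← ENNReal.ofReal_coe_nnreal, ← ENNReal.ofReal_mul C.coe_nonneg,
    ENNReal.ofReal_le_ofReal_iff (mul_nonneg C.coe_nonneg hy)]

-- If `4 ^ n * p (i n) < z n < q (i n)`, the weights `2 ^ n / z n` make the `p`-series geometric.
theorem exists_le_mul_of_tsum_lt_top {ι : Type*} {p q : ι → ℝ≥0∞}
    (h : ∀ (a : ℕ → ℝ≥0) (i : ℕ → ι), ∑' n, a n * p (i n) < ∞ → ⨆ n, a n * q (i n) < ∞) :
    ∃ C : ℝ≥0, ∀ i, q i ≤ C * p i := by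
  by_contra! hcon
  choose i hi using fun n : ℕ => hcon (4 ^ n)
  choose z hpz hzq using fun n => ENNReal.lt_iff_exists_nnreal_btwn.1 (hi n)
  have hz (n : ℕ) : z n ≠ 0 := ENNReal.coe_ne_zero.1 (pos_of_gt (hpz n)).ne'
  let a (n : ℕ) : ℝ≥0 := 2⁻¹ ^ n * ((z n)⁻¹ * 4 ^ n)
  have hp (n : ℕ) : a n * p (i n) ≤ 2⁻¹ ^ n := by
    calc (a n : ℝ≥0∞) * p (i n)
        = ((2⁻¹ ^ n * (z n)⁻¹ : ℝ≥0) : ℝ≥0∞) * ((4 ^ n : ℝ≥0) * p (i n)) := by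
          simp only [a]
          push_cast
          ring
      _ ≤ ((2⁻¹ ^ n * (z n)⁻¹ : ℝ≥0) : ℝ≥0∞) * z n := by gcongr; exact (hpz n).le
      _ = 2⁻¹ ^ n := by
          rw [← ENNReal.coe_mul, inv_mul_cancel_right₀ (hz n)]
          simp [ENNReal.inv_pow]
  have hq (n : ℕ) : 2 ^ n ≤ a n * q (i n) := by
    calc (2 : ℝ≥0∞) ^ n = ((a n * z n : ℝ≥0) : ℝ≥0∞) := by
          have : a n * z n = 2 ^ n := by
            simp only [a]
            field_simp [hz n]
            rw [← mul_pow]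
            norm_num
          simp [this]
      _ ≤ a n * q (i n) := by rw [ENNReal.coe_mul]; gcongr; exact (hzq n).le
  have hsum : ∑' n, a n * p (i n) < ∞ :=
    (ENNReal.tsum_le_tsum hp).trans_lt (by simp)
  obtain ⟨n, hn⟩ := ENNReal.exists_nat_gt (h a i hsum).ne
  refine hn.not_ge (le_trans ?_ ((hq n).trans (le_iSup (fun n => a n * q (i n)) n)))
  exact_mod_cast n.lt_two_pow_self.le

theorem tsum_zpow_two_le (m : ℤ) :
    ∑' k : ℤ, (if k ≤ m then (2 : ℝ≥0∞) ^ k else 0) = 2 * 2 ^ m := by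
  have hinj : Function.Injective fun j : ℕ => m - (j : ℤ) := fun a b h => by
    simpa using h
  have hterm (j : ℕ) : (if m - (j : ℤ) ≤ m then (2 : ℝ≥0∞) ^ (m - (j : ℤ)) else 0) =
      2 ^ m * 2⁻¹ ^ j := by
    rw [if_pos (by omega), sub_eq_add_neg, ENNReal.zpow_add (by simp) (by simp),
      ENNReal.zpow_neg, zpow_natCast, ENNReal.inv_pow]
  rw [← hinj.tsum_eq]
  · simp_rw [hterm]
    rw [ENNReal.tsum_mul_left, ENNReal.tsum_geometric, ENNReal.one_sub_inv_two, inv_inv, mul_comm]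
  · intro k hk
    have hkm : k ≤ m := by
      by_contra h
      simp [h] at hk
    exact ⟨(m - k).toNat, by simp only; omega⟩

/-- The sum of the dyadic numbers `2 ^ k`, `k ∈ ℤ`, below `y`: a discrete substitute for `y`
that is a countable combination of indicators of upper level sets. -/
noncomputable def dyadicSum (y : ℝ≥0∞) : ℝ≥0∞ :=
  ∑' k : ℤ, if (2 : ℝ≥0∞) ^ k < y then (2 : ℝ≥0∞) ^ k else 0

theorem exists_dyadicSum_eq {y : ℝ≥0∞} (h0 : y ≠ 0) (hy : y ≠ ∞) :
    ∃ m : ℤ, 2 ^ m < y ∧ y ≤ 2 * 2 ^ m ∧ dyadicSum y = 2 * 2 ^ m := by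
  obtain ⟨m, hmy, hym⟩ := ENNReal.exists_mem_Ioc_zpow h0 hy (y := 2) (by norm_num) (by simp)
  have hiff (k : ℤ) : (2 : ℝ≥0∞) ^ k < y ↔ k ≤ m := by
    refine ⟨fun h => ?_, fun h => (ENNReal.zpow_le_of_le one_le_two h).trans_lt hmy⟩
    by_contra hk
    exact h.not_ge (hym.trans (ENNReal.zpow_le_of_le one_le_two (by omega)))
  refine ⟨m, hmy, ?_, ?_⟩
  · rwa [ENNReal.zpow_add (by simp) (by simp), zpow_one, mul_comm] at hym
  · simp_rw [dyadicSum, hiff, tsum_zpow_two_le]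

theorem le_dyadicSum {y : ℝ≥0∞} (hy : y ≠ ∞) : y ≤ dyadicSum y := by
  rcases eq_or_ne y 0 with rfl | h0
  · exact zero_le
  · obtain ⟨m, -, hym, h⟩ := exists_dyadicSum_eq h0 hy
    exact hym.trans_eq h.symm

theorem dyadicSum_le (y : ℝ≥0∞) : dyadicSum y ≤ 2 * y := by
  rcases eq_or_ne y 0 with rfl | h0
  · simp [dyadicSum]
  rcases eq_or_ne y ∞ with rfl | hy
  · simp
  · obtain ⟨m, hmy, -, h⟩ := exists_dyadicSum_eq h0 hy
    rw [h]
    gcongr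

theorem lintegral_dyadicSum {α : Type*} [MeasurableSpace α] {μ : Measure α} {h : α → ℝ≥0∞}
    (hh : AEMeasurable h μ) :
    ∫⁻ x, dyadicSum (h x) ∂μ = ∑' k : ℤ, 2 ^ k * μ {x | (2 : ℝ≥0∞) ^ k < h x} := by
  have hmeas (k : ℤ) : NullMeasurableSet {x | (2 : ℝ≥0∞) ^ k < h x} μ :=
    nullMeasurableSet_lt aemeasurable_const hh
  have hind (k : ℤ) : (fun x => if (2 : ℝ≥0∞) ^ k < h x then (2 : ℝ≥0∞) ^ k else 0) =
      {x | (2 : ℝ≥0∞) ^ k < h x}.indicator fun _ => 2 ^ k := by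
    ext x
    simp [indicator]
  unfold dyadicSum
  rw [lintegral_tsum fun k => by rw [hind]; exact aemeasurable_const.indicator₀ (hmeas k)]
  simp_rw [hind, lintegral_indicator_const₀ (hmeas _)]

/-! ### The half-line -/

instance : SigmaFinite halfLine := by
  unfold halfLine
  infer_instance

theorem ae_halfLine_pos : ∀ᵐ x ∂halfLine, 0 < x := ae_restrict_mem measurableSet_Ioi

theorem restrict_Ioc_le_halfLine (t : ℝ) : volume.restrict (Ioc 0 t) ≤ halfLine :=
  Measure.restrict_mono Ioc_subset_Ioi_self le_rfl

theorem halfLine_Iio (t : ℝ) : halfLine (Iio t) = ENNReal.ofReal t := by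
  rw [halfLine, Measure.restrict_apply measurableSet_Iio, Iio_inter_Ioi, Real.volume_Ioo, sub_zero]

theorem halfLine_Iic (t : ℝ) : halfLine (Iic t) = ENNReal.ofReal t := by
  rw [halfLine, Measure.restrict_apply measurableSet_Iic, inter_comm, Ioi_inter_Iic,
    Real.volume_Ioc, sub_zero]

theorem halfLine_ofReal_lt (y : ℝ≥0∞) : halfLine {t | ENNReal.ofReal t < y} = y := by
  rcases eq_or_ne y ∞ with rfl | hy
  · simp [halfLine]
  · have h : {t | ENNReal.ofReal t < y} ∩ Ioi 0 = Ioo 0 y.toReal := by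
      ext t
      simp only [mem_inter_iff, mem_ofPred_eq, mem_Ioi, mem_Ioo, and_comm (b := 0 < t)]
      exact and_congr_right fun ht => ENNReal.ofReal_lt_iff_lt_toReal ht.le hy
    rw [halfLine, Measure.restrict_apply (measurableSet_lt (by fun_prop) measurable_const), h,
      Real.volume_Ioo, sub_zero, ENNReal.ofReal_toReal hy]

theorem lintegral_measure_ofReal_lt_comm {α : Type*} [MeasurableSpace α] {μ : Measure α}
    {ν : Measure ℝ} [SFinite μ] [SFinite ν] {h : α → ℝ≥0∞} (hh : AEMeasurable h μ) :
    ∫⁻ x, ν {t | ENNReal.ofReal t < h x} ∂μ = ∫⁻ t, μ {x | ENNReal.ofReal t < h x} ∂ν := by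
  have hcongr (t : ℝ) : μ {x | ENNReal.ofReal t < h x} = μ {x | ENNReal.ofReal t < hh.mk h x} := by
    refine measure_congr (hh.ae_eq_mk.mono fun x hx => ?_)
    change (_ < h x) = (_ < hh.mk h x)
    rw [hx]
  have hset : MeasurableSet {p : α × ℝ | ENNReal.ofReal p.2 < hh.mk h p.1} :=
    measurableSet_lt (by fun_prop) (hh.measurable_mk.comp measurable_fst)
  calc ∫⁻ x, ν {t | ENNReal.ofReal t < h x} ∂μ
      = ∫⁻ x, ν {t | ENNReal.ofReal t < hh.mk h x} ∂μ :=
        lintegral_congr_ae (hh.ae_eq_mk.mono fun x hx => by simp only [hx])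
    _ = (μ.prod ν) {p : α × ℝ | ENNReal.ofReal p.2 < hh.mk h p.1} :=
        (Measure.prod_apply hset).symm
    _ = ∫⁻ t, μ {x | ENNReal.ofReal t < hh.mk h x} ∂ν := Measure.prod_apply_symm hset
    _ = ∫⁻ t, μ {x | ENNReal.ofReal t < h x} ∂ν := by simp_rw [hcongr]

-- `lintegral_eq_lintegral_meas_lt` covers real-valued functions only.
theorem lintegral_eq_lintegral_meas_ofReal_lt {α : Type*} [MeasurableSpace α] {μ : Measure α}
    [SFinite μ] {h : α → ℝ≥0∞} (hh : AEMeasurable h μ) :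
    ∫⁻ x, h x ∂μ = ∫⁻ t, μ {x | ENNReal.ofReal t < h x} ∂halfLine := by
  simp_rw [← lintegral_measure_ofReal_lt_comm hh, halfLine_ofReal_lt]

/-! ### Distribution function and rearrangement -/

theorem distribution_anti (f : ℝ → ℝ≥0∞) : Antitone (distribution f) :=
  fun _ _ h => measure_mono fun _ hx => h.trans_lt hx

theorem exists_gt_lt_distribution {c l : ℝ≥0∞} (h : c < distribution f l) :
    ∃ m > l, c < distribution f m := by
  have hl : l < ∞ := by
    refine lt_top_iff_ne_top.2 fun hl => ?_
    simp [hl, distribution] at h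
  obtain ⟨u, hu, hul, hlim⟩ := exists_seq_strictAnti_tendsto' hl
  have hU : {x | l < f x} = ⋃ n, {x | u n < f x} := by
    ext x
    simp only [mem_ofPred_eq, mem_iUnion]
    exact ⟨fun hx => (hlim.eventually_lt_const hx).exists, fun ⟨n, hn⟩ => (hul n).1.trans hn⟩
  have hmono : Monotone fun n => {x | u n < f x} := fun m n hmn x hx =>
    (hu.antitone hmn).trans_lt hx
  rw [distribution, hU, hmono.measure_iUnion, lt_iSup_iff] at h
  obtain ⟨n, hn⟩ := h
  exact ⟨u n, (hul n).1, hn⟩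

theorem lt_sInf_distribution_le_iff (f : ℝ → ℝ≥0∞) (c l : ℝ≥0∞) :
    l < sInf {m | distribution f m ≤ c} ↔ c < distribution f l := by
  refine ⟨fun h => not_le.1 fun hn => h.not_ge (sInf_le hn), fun h => ?_⟩
  obtain ⟨m, hlm, hm⟩ := exists_gt_lt_distribution h
  refine hlm.trans_le (le_sInf fun l' hl' => not_lt.1 fun hlt => ?_)
  exact (hm.trans_le (distribution_anti _ hlt.le)).not_ge hl'

theorem lt_rearrangement_iff (f : ℝ → ℝ) (t : ℝ) (l : ℝ≥0∞) :
    l < rearrangement f t ↔ ENNReal.ofReal t < distribution (fun x => ‖f x‖ₑ) l :=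
  lt_sInf_distribution_le_iff _ _ _

theorem rearrangement_anti (f : ℝ → ℝ) : Antitone (rearrangement f) := fun _ _ h =>
  sInf_le_sInf fun _ hl => le_trans hl (ENNReal.ofReal_le_ofReal h)

theorem rearrangement_le_of_antitone {f : ℝ → ℝ} {F : ℝ → ℝ≥0∞} (hF : Antitone F)
    (hf : ∀ x, ‖f x‖ₑ ≤ F x) (t : ℝ) : rearrangement f t ≤ F t := by
  refine sInf_le ?_
  change halfLine {x | F t < ‖f x‖ₑ} ≤ ENNReal.ofReal t
  rw [← halfLine_Iio]
  exact measure_mono fun x hx => not_le.1 fun htx => hx.not_ge ((hf x).trans (hF htx))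

theorem le_rearrangement {f : ℝ → ℝ} {c : ℝ≥0∞} (hf : ∀ x, 0 < x → x < a → c ≤ ‖f x‖ₑ)
    (ha : 0 < a) (hta : t < a) : c ≤ rearrangement f t := by
  refine le_of_forall_lt fun l hl => ?_
  rw [lt_rearrangement_iff]
  refine ((ENNReal.ofReal_lt_ofReal_iff ha).2 hta).trans_le ?_
  rw [← halfLine_Iio]
  refine measure_mono_ae ?_
  filter_upwards [ae_halfLine_pos] with x hx hxa
  exact hl.trans_le (hf x hx hxa)

/-! ### Quasi-concave functions -/

namespace QuasiConcave

theorem le_max_one_div_mul (hφ : QuasiConcave φ) {s : ℝ} (hs : 0 < s) (ht : 0 < t) :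
    φ s ≤ max 1 (s / t) * φ t := by
  rcases le_total s t with hst | hts
  · exact (hφ.mono s t hs hst).trans
      (le_mul_of_one_le_left (hφ.pos t ht).le (le_max_left _ _))
  · calc φ s ≤ φ t / t * s := (div_le_iff₀ hs).1 (hφ.div_anti t s ht hts)
      _ = s / t * φ t := by ring
      _ ≤ max 1 (s / t) * φ t :=
        mul_le_mul_of_nonneg_right (le_max_right _ _) (hφ.pos t ht).le

theorem continuousAt (hφ : QuasiConcave φ) (ht : 0 < t) : ContinuousAt φ t := by
  have hlim : Filter.Tendsto (fun s => φ t / max 1 (t / s)) (nhds t) (nhds (φ t)) := by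
    have h : ContinuousAt (fun s => φ t / max 1 (t / s)) t := by
      fun_prop (disch := positivity)
    simpa [ContinuousAt, div_self ht.ne'] using h
  have hlim' : Filter.Tendsto (fun s => max 1 (s / t) * φ t) (nhds t) (nhds (φ t)) := by
    have h : ContinuousAt (fun s => max 1 (s / t) * φ t) t := by fun_prop
    simpa [ContinuousAt, div_self ht.ne'] using h
  refine tendsto_of_tendsto_of_tendsto_of_le_of_le' hlim hlim' ?_ ?_
  · filter_upwards [lt_mem_nhds ht] with s hs
    exact (div_le_iff₀' (by positivity)).2 (hφ.le_max_one_div_mul ht hs)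
  · filter_upwards [lt_mem_nhds ht] with s hs
    exact hφ.le_max_one_div_mul hs ht

instance (hφ : QuasiConcave φ) : SigmaFinite hφ.measure := by
  unfold QuasiConcave.measure
  infer_instance

theorem measure_Iio (hφ : QuasiConcave φ) (ht : 0 < t) :
    hφ.measure (Iio t) = ENNReal.ofReal (φ t) := by
  have hmono := hφ.monotone_extend
  set g : ℝ → ℝ := fun t => if t ≤ 0 then 0 else φ t
  have hbot : Filter.Tendsto hmono.stieltjesFunction Filter.atBot (nhds 0) := by
    refine tendsto_const_nhds.congr' ?_
    filter_upwards [Filter.eventually_lt_atBot (0 : ℝ)] with s hs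
    have hlow : g s ≤ hmono.stieltjesFunction s := hmono.le_rightLim le_rfl
    have hup : hmono.stieltjesFunction s ≤ g 0 := hmono.rightLim_le hs
    simp only [g, hs.le, le_refl, if_true] at hlow hup
    exact le_antisymm hlow hup
  have hcont : ContinuousAt g t := by
    refine (hφ.continuousAt ht).congr ?_
    filter_upwards [lt_mem_nhds ht] with s hs
    exact (if_neg hs.not_ge).symm
  have hleft : Function.leftLim hmono.stieltjesFunction t = φ t := by
    change Function.leftLim (Function.rightLim g) t = φ t
    rw [leftLim_rightLim (hmono.tendsto_leftLim t),
      hcont.continuousWithinAt.leftLim_eq]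
    exact if_neg ht.not_ge
  rw [measure, StieltjesFunction.measure_Iio _ hbot, hleft, sub_zero]

/-- The `dφ`-measure of `[0, a)` for `a ∈ [0, ∞]`, that is, `φ` extended to `[0, ∞]` by
`φ 0 = 0` and `φ ∞ = sup φ`. -/
noncomputable def mass (hφ : QuasiConcave φ) (a : ℝ≥0∞) : ℝ≥0∞ :=
  hφ.measure {t | ENNReal.ofReal t < a}

theorem mass_mono (hφ : QuasiConcave φ) : Monotone hφ.mass :=
  fun _ _ h => measure_mono fun _ hx => lt_of_lt_of_le hx h

theorem mass_ofReal (hφ : QuasiConcave φ) (ht : 0 < t) :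
    hφ.mass (ENNReal.ofReal t) = ENNReal.ofReal (φ t) := by
  simp only [mass, ENNReal.ofReal_lt_ofReal_iff ht]
  exact hφ.measure_Iio ht

theorem mass_top (hφ : QuasiConcave φ) :
    hφ.mass ∞ = ⨆ n : ℕ, hφ.mass (ENNReal.ofReal (n + 1)) := by
  have hmono : Monotone fun n : ℕ => {t : ℝ | ENNReal.ofReal t < ENNReal.ofReal (n + 1)} :=
    fun m n h t ht => lt_of_lt_of_le ht (ENNReal.ofReal_le_ofReal (by gcongr))
  simp only [mass]
  rw [← hmono.measure_iUnion]
  congr 1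
  ext t
  simp only [ENNReal.ofReal_lt_top, ofPred_true, mem_univ, mem_iUnion, mem_ofPred_eq, true_iff]
  obtain ⟨n, hn⟩ := exists_nat_gt t
  exact ⟨n, (ENNReal.ofReal_lt_ofReal_iff (by positivity)).2 (by linarith)⟩

theorem mass_le_mul (hφ : QuasiConcave φ) (hψ : QuasiConcave ψ)
    (h : ∀ t, 0 < t → ψ t ≤ C * φ t) (a : ℝ≥0∞) : hψ.mass a ≤ C * hφ.mass a := by
  have hreal (t : ℝ) (ht : 0 < t) :
      hψ.mass (ENNReal.ofReal t) ≤ C * hφ.mass (ENNReal.ofReal t) := by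
    rw [hψ.mass_ofReal ht, hφ.mass_ofReal ht, ofReal_le_coe_mul_ofReal (hφ.pos t ht).le]
    exact h t ht
  rcases eq_or_ne a ∞ with rfl | ha
  · rw [hψ.mass_top]
    refine iSup_le fun n => (hreal _ (by positivity)).trans ?_
    gcongr
    exact hφ.mass_mono le_top
  rcases eq_or_ne a 0 with rfl | h0
  · simp [mass]
  · rw [← ENNReal.ofReal_toReal ha]
    exact hreal _ (ENNReal.toReal_pos h0 ha)

theorem measure_lt_rearrangement (hφ : QuasiConcave φ) (f : ℝ → ℝ) (l : ℝ≥0∞) :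
    hφ.measure {t | l < rearrangement f t} = hφ.mass (distribution (fun x => ‖f x‖ₑ) l) := by
  simp_rw [lt_rearrangement_iff, mass]

end QuasiConcave

/-! ### Lorentz spaces -/

theorem lorentzNorm_eq_lintegral_mass (hφ : QuasiConcave φ) (f : ℝ → ℝ) :
    lorentzNorm hφ f =
      ∫⁻ l, hφ.mass (distribution (fun x => ‖f x‖ₑ) (ENNReal.ofReal l)) ∂halfLine := by
  rw [lorentzNorm,
    lintegral_eq_lintegral_meas_ofReal_lt (rearrangement_anti f).measurable.aemeasurable]
  simp_rw [hφ.measure_lt_rearrangement]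

theorem tsum_mass_distribution_le (hφ : QuasiConcave φ) (f : ℝ → ℝ) :
    ∑' k : ℤ, 2 ^ k * hφ.mass (distribution (fun x => ‖f x‖ₑ) (2 ^ k)) ≤
      2 * lorentzNorm hφ f := by
  have hmeas : Measurable (rearrangement f) := (rearrangement_anti f).measurable
  calc ∑' k : ℤ, 2 ^ k * hφ.mass (distribution (fun x => ‖f x‖ₑ) (2 ^ k))
      = ∫⁻ t, dyadicSum (rearrangement f t) ∂hφ.measure := by
        simp_rw [lintegral_dyadicSum hmeas.aemeasurable, hφ.measure_lt_rearrangement]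
    _ ≤ ∫⁻ t, 2 * rearrangement f t ∂hφ.measure := lintegral_mono fun t => dyadicSum_le _
    _ = 2 * lorentzNorm hφ f := lintegral_const_mul _ hmeas

theorem lorentzNorm_le_mul (hφ : QuasiConcave φ) (hψ : QuasiConcave ψ)
    (h : ∀ t, 0 < t → ψ t ≤ C * φ t) (f : ℝ → ℝ) :
    lorentzNorm hψ f ≤ C * lorentzNorm hφ f := by
  rw [lorentzNorm_eq_lintegral_mass, lorentzNorm_eq_lintegral_mass,
    ← lintegral_const_mul' _ _ ENNReal.coe_ne_top]
  exact lintegral_mono fun l => hφ.mass_le_mul hψ h _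

theorem lorentzNorm_le_lintegral (hφ : QuasiConcave φ) {f : ℝ → ℝ} {F : ℝ → ℝ≥0∞}
    (hF : Antitone F) (hf : ∀ x, ‖f x‖ₑ ≤ F x) : lorentzNorm hφ f ≤ ∫⁻ x, F x ∂hφ.measure :=
  lintegral_mono (rearrangement_le_of_antitone hF hf)

theorem mul_le_lorentzNorm (hφ : QuasiConcave φ) {f : ℝ → ℝ} {c : ℝ≥0∞} (ha : 0 < a)
    (hf : ∀ x, 0 < x → x < a → c ≤ ‖f x‖ₑ) : c * ENNReal.ofReal (φ a) ≤ lorentzNorm hφ f := by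
  rw [← hφ.measure_Iio ha, ← lintegral_indicator_const measurableSet_Iio]
  exact lintegral_mono (indicator_le fun t ht => le_rearrangement hf ha ht)

theorem antitone_indicator_Iio (a : ℝ) (c : ℝ≥0∞) : Antitone ((Iio a).indicator fun _ => c) := by
  intro x y hxy
  by_cases hy : y < a
  · simp [hy, hxy.trans_lt hy]
  · simp [hy]

theorem lt_top_of_antitone (hφ : QuasiConcave φ) {F : ℝ → ℝ≥0∞} (hF : Antitone F)
    (hfin : ∫⁻ x, F x ∂hφ.measure < ∞) {x : ℝ} (hx : 0 < x) : F x < ∞ := by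
  have hle : F x * ENNReal.ofReal (φ x) ≤ ∫⁻ x, F x ∂hφ.measure := by
    rw [← hφ.measure_Iio hx, ← lintegral_indicator_const measurableSet_Iio]
    exact lintegral_mono (indicator_le fun t ht => hF (le_of_lt ht))
  exact ENNReal.lt_top_of_mul_ne_top_left (hle.trans_lt hfin).ne
    (ENNReal.ofReal_pos.2 (hφ.pos x hx)).ne'

theorem exists_le_mul_of_lorentzSpace_subset (hφ : QuasiConcave φ) (hψ : QuasiConcave ψ)
    (h : lorentzSpace hφ ⊆ lorentzSpace hψ) : ∃ C : ℝ≥0, ∀ t, 0 < t → ψ t ≤ C * φ t := by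
  suffices hhump : ∀ (a : ℕ → ℝ≥0) (t : ℕ → Ioi (0 : ℝ)),
      ∑' n, a n * ENNReal.ofReal (φ (t n)) < ∞ → ⨆ n, a n * ENNReal.ofReal (ψ (t n)) < ∞ by
    obtain ⟨C, hC⟩ := exists_le_mul_of_tsum_lt_top (ι := Ioi (0 : ℝ))
      (p := fun t => ENNReal.ofReal (φ t)) (q := fun t => ENNReal.ofReal (ψ t)) hhump
    exact ⟨C, fun t ht => (ofReal_le_coe_mul_ofReal (hφ.pos t ht).le).1 (hC ⟨t, ht⟩)⟩
  intro a t hsum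
  let F (x : ℝ) : ℝ≥0∞ := ∑' n, (Iio (t n : ℝ)).indicator (fun _ => (a n : ℝ≥0∞)) x
  have hF : Antitone F := fun x y hxy =>
    ENNReal.tsum_le_tsum fun n => antitone_indicator_Iio _ _ hxy
  have hint : ∫⁻ x, F x ∂hφ.measure < ∞ := by
    rw [lintegral_tsum fun n => (measurable_const.indicator measurableSet_Iio).aemeasurable]
    simpa only [lintegral_indicator_const measurableSet_Iio, hφ.measure_Iio (t _).2] using hsum
  have hmem : (fun x => (F x).toReal) ∈ lorentzSpace hφ := by
    refine ⟨hF.measurable.ennreal_toReal.aemeasurable,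
      (lorentzNorm_le_lintegral hφ hF fun x => ?_).trans_lt hint⟩
    rw [Real.enorm_of_nonneg ENNReal.toReal_nonneg]
    exact ENNReal.ofReal_toReal_le
  refine (iSup_le fun n => mul_le_lorentzNorm hψ (t n).2 fun x hx hxt => ?_).trans_lt (h hmem).2
  rw [Real.enorm_of_nonneg ENNReal.toReal_nonneg,
    ENNReal.ofReal_toReal (lt_top_of_antitone hφ hF hint hx).ne]
  calc (a n : ℝ≥0∞) = (Iio (t n : ℝ)).indicator (fun _ => (a n : ℝ≥0∞)) x :=
        (indicator_of_mem (mem_Iio.2 hxt) fun _ => _).symm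
    _ ≤ F x := ENNReal.le_tsum n

theorem lorentzSpace_subset_iff (hφ : QuasiConcave φ) (hψ : QuasiConcave ψ) :
    lorentzSpace hφ ⊆ lorentzSpace hψ ↔ ∃ C : ℝ≥0, ∀ t, 0 < t → ψ t ≤ C * φ t :=
  ⟨exists_le_mul_of_lorentzSpace_subset hφ hψ, fun ⟨_, hC⟩ f hf => ⟨hf.1,
    (lorentzNorm_le_mul hφ hψ hC f).trans_lt (ENNReal.mul_lt_top ENNReal.coe_lt_top hf.2)⟩⟩

theorem lorentzNorm_indicator_Iio_le (hφ : QuasiConcave φ) (ha : 0 < a) :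
    lorentzNorm hφ ((Iio a).indicator fun _ => 1) ≤ ENNReal.ofReal (φ a) := by
  refine (lorentzNorm_le_lintegral hφ (antitone_indicator_Iio a 1) fun x => ?_).trans_eq ?_
  · simp [enorm_indicator_eq_indicator_enorm]
  · rw [lintegral_indicator_const measurableSet_Iio, hφ.measure_Iio ha, one_mul]

theorem indicator_Iio_mem_lorentzSpace (hφ : QuasiConcave φ) (ha : 0 < a) :
    ((Iio a).indicator fun _ => 1) ∈ lorentzSpace hφ :=
  ⟨(measurable_const.indicator measurableSet_Iio).aemeasurable,
    (lorentzNorm_indicator_Iio_le hφ ha).trans_lt ENNReal.ofReal_lt_top⟩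

/-! ### Rearrangement invariant spaces -/

namespace RISpace

theorem ρ_zero (X : RISpace) : X.ρ (fun _ => 0) = 0 :=
  (X.eq_zero_iff _ aemeasurable_const).2 Filter.EventuallyEq.rfl

theorem ρ_sum_le {ι : Type*} (X : RISpace) (s : Finset ι) {f : ι → ℝ → ℝ≥0∞}
    (hf : ∀ i, AEMeasurable (f i) halfLine) :
    X.ρ (fun x => ∑ i ∈ s, f i x) ≤ ∑ i ∈ s, X.ρ (f i) := by
  classical
  induction s using Finset.induction_on with
  | empty => simp [X.ρ_zero]
  | insert i s hi ih =>
    simp_rw [Finset.sum_insert hi]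
    exact (X.add_le _ _ (hf i) (Finset.aemeasurable_fun_sum s fun j _ => hf j)).trans
      (add_le_add le_rfl ih)

theorem ρ_tsum_le {ι : Type*} [Denumerable ι] (X : RISpace) {f : ι → ℝ → ℝ≥0∞}
    (hf : ∀ i, AEMeasurable (f i) halfLine) :
    X.ρ (fun x => ∑' i, f i x) ≤ ∑' i, X.ρ (f i) := by
  let e := (Denumerable.eqv ι).symm
  simp_rw [← e.tsum_eq (f · _), ← e.tsum_eq (X.ρ <| f ·), ENNReal.tsum_eq_iSup_nat]
  rw [X.fatou (fun n x => ∑ i ∈ Finset.range n, f (e i) x)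
    (fun n => Finset.aemeasurable_fun_sum _ fun j _ => hf _)
    (Filter.Eventually.of_forall fun x m n hmn =>
      Finset.sum_le_sum_of_subset (Finset.range_mono hmn))]
  exact iSup_mono fun n => X.ρ_sum_le _ fun _ => hf _

theorem ae_lt_top {f : ℝ → ℝ≥0∞} (hf : AEMeasurable f halfLine) (h : X.ρ f < ∞) :
    ∀ᵐ x ∂halfLine, f x < ∞ := by
  refine ae_of_forall_measure_lt_top_ae_restrict _ fun E hE hfin => ?_
  obtain ⟨C, hC⟩ := X.setLIntegral_le E hE hfin
  exact ae_lt_top' hf.restrict ((hC f hf).trans_lt (ENNReal.mul_lt_top ENNReal.coe_lt_top h)).ne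

theorem ρ_lt_top_of_carrier_subset (h : Y.carrier ⊆ X.carrier)
    (hf : AEMeasurable f halfLine) (hY : Y.ρ f < ∞) : X.ρ f < ∞ := by
  have hae : ∀ᵐ x ∂halfLine, ‖(f x).toReal‖ₑ = f x := by
    filter_upwards [ae_lt_top hf hY] with x hx
    rw [Real.enorm_of_nonneg ENNReal.toReal_nonneg, ENNReal.ofReal_toReal hx.ne]
  have hm : AEMeasurable (fun x => (f x).toReal) halfLine := hf.ennreal_toReal
  have hmem : (fun x => (f x).toReal) ∈ X.carrier :=
    h ⟨hm, (Y.mono _ _ hm.enorm hf (hae.mono fun _ hx => hx.le)).trans_lt hY⟩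
  exact (X.mono _ _ hf hm.enorm (hae.mono fun _ hx => hx.ge)).trans_lt hmem.2

theorem exists_ρ_le_mul_of_carrier_subset (h : Y.carrier ⊆ X.carrier) :
    ∃ C : ℝ≥0, ∀ f, AEMeasurable f halfLine → X.ρ f ≤ C * Y.ρ f := by
  suffices hhump : ∀ (a : ℕ → ℝ≥0) (f : ℕ → {f : ℝ → ℝ≥0∞ // AEMeasurable f halfLine}),
      ∑' n, a n * Y.ρ (f n) < ∞ → ⨆ n, a n * X.ρ (f n) < ∞ by
    obtain ⟨C, hC⟩ := exists_le_mul_of_tsum_lt_top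
      (p := fun f : {f : ℝ → ℝ≥0∞ // AEMeasurable f halfLine} => Y.ρ f) (q := fun f => X.ρ f) hhump
    exact ⟨C, fun f hf => hC ⟨f, hf⟩⟩
  intro a f hsum
  have hm (n : ℕ) : AEMeasurable (fun x => a n * (f n : ℝ → ℝ≥0∞) x) halfLine :=
    (f n).2.const_mul _
  have hFm : AEMeasurable (fun x => ∑' n, a n * (f n : ℝ → ℝ≥0∞) x) halfLine :=
    AEMeasurable.tsum hm
  simp_rw [← Y.smul _ _ (f _).2] at hsum
  simp_rw [← X.smul _ _ (f _).2]
  have hX := ρ_lt_top_of_carrier_subset h hFm ((Y.ρ_tsum_le hm).trans_lt hsum)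
  refine (iSup_le fun n => X.mono _ _ (hm n) hFm ?_).trans_lt hX
  exact Filter.Eventually.of_forall fun x => ENNReal.le_tsum (f := fun n => a n * (f n).1 x) n

/-- The space `X` with its norm multiplied by a constant `c ≠ 0`. -/
noncomputable def scale (X : RISpace) (c : ℝ≥0) (hc : c ≠ 0) : RISpace where
  ρ f := c * X.ρ f
  eq_zero_iff f hf := by simp [hc, X.eq_zero_iff f hf]
  smul a f hf := by rw [X.smul a f hf, mul_left_comm]
  add_le f g hf hg := by
    rw [← mul_add]
    gcongr
    exact X.add_le f g hf hg
  mono f g hf hg h := by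
    gcongr
    exact X.mono f g hf hg h
  fatou f hf hmono := by rw [X.fatou f hf hmono, ENNReal.mul_iSup]
  indicator_lt_top E hE hfin :=
    ENNReal.mul_lt_top ENNReal.coe_lt_top (X.indicator_lt_top E hE hfin)
  setLIntegral_le E hE hfin := by
    obtain ⟨C, hC⟩ := X.setLIntegral_le E hE hfin
    refine ⟨C * c⁻¹, fun f hf => (hC f hf).trans_eq ?_⟩
    rw [← mul_assoc, ← ENNReal.coe_mul, inv_mul_cancel_right₀ hc]
  rearrangement_invariant f g hf hg h := by rw [X.rearrangement_invariant f g hf hg h]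

/-- The r.i. space whose norm is the supremum of a family of r.i. norms, provided the supremum is
finite on indicators of sets of finite measure. -/
noncomputable def sup {ι : Type*} [Nonempty ι] (Z : ι → RISpace)
    (hfin : ∀ E : Set ℝ, MeasurableSet E → halfLine E < ∞ →
      ⨆ i, (Z i).ρ (E.indicator fun _ => 1) < ∞) : RISpace where
  ρ f := ⨆ i, (Z i).ρ f
  eq_zero_iff f hf := by simp [(Z _).eq_zero_iff f hf]
  smul a f hf := by simp_rw [(Z _).smul a f hf, ENNReal.mul_iSup]
  add_le f g hf hg := iSup_le fun i => ((Z i).add_le f g hf hg).trans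
    (add_le_add (le_iSup (fun i => (Z i).ρ f) i) (le_iSup (fun i => (Z i).ρ g) i))
  mono f g hf hg h := iSup_mono fun i => (Z i).mono f g hf hg h
  fatou f hf hmono := by
    simp_rw [(Z _).fatou f hf hmono]
    exact iSup_comm
  indicator_lt_top := hfin
  setLIntegral_le E hE hE' := by
    obtain ⟨i⟩ := ‹Nonempty ι›
    obtain ⟨C, hC⟩ := (Z i).setLIntegral_le E hE hE'
    refine ⟨C, fun f hf => (hC f hf).trans ?_⟩
    gcongr
    exact le_iSup (fun i => (Z i).ρ f) i
  rearrangement_invariant f g hf hg h := by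
    simp_rw [(Z _).rearrangement_invariant f g hf hg h]

end RISpace

/-! ### The test functions -/

/-- The function `s ↦ 1 / (1 + s / t)`, whose norm in `X` is `W_X t`. -/
noncomputable abbrev kernel (t s : ℝ) : ℝ := 1 / (1 + s / t)

theorem kernel_one : kernel 1 = fun s => 1 / (1 + s) :=
  funext fun s => by rw [kernel, div_one]

theorem aemeasurable_enorm_kernel (t : ℝ) : AEMeasurable (fun s => ‖kernel t s‖ₑ) halfLine :=
  (RISpace.measurable_kernel t).enorm.aemeasurable

theorem distribution_indicator_one (E : Set ℝ) (l : ℝ≥0∞) :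
    distribution (E.indicator fun _ => 1) l = if l < 1 then halfLine E else 0 := by
  have hset : {x | l < E.indicator (fun _ => 1) x} = if l < 1 then E else ∅ := by
    ext x
    by_cases hx : x ∈ E <;> split_ifs with hl <;> simp [hx, hl]
  rw [distribution, hset]
  split_ifs <;> simp

namespace RISpace

theorem ρ_indicator_congr (X : RISpace) {F : Set ℝ} (hE : MeasurableSet E) (hF : MeasurableSet F)
    (h : halfLine E = halfLine F) :
    X.ρ (E.indicator fun _ => 1) = X.ρ (F.indicator fun _ => 1) :=
  X.rearrangement_invariant _ _ (measurable_const.indicator hE).aemeasurable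
    (measurable_const.indicator hF).aemeasurable fun l => by
      rw [distribution_indicator_one, distribution_indicator_one, h]

theorem ρ_indicator_le (X : RISpace) (ha : 0 < a) (hE : MeasurableSet E)
    (hEa : halfLine E ≤ ENNReal.ofReal a) :
    X.ρ (E.indicator fun _ => 1) ≤ 2 * X.norm (kernel a) := by
  have hfin : halfLine E ≠ ∞ := (hEa.trans_lt ENNReal.ofReal_lt_top).ne
  have hIio : halfLine E = halfLine (Iio (halfLine E).toReal) := by
    rw [halfLine_Iio, ENNReal.ofReal_toReal hfin]
  have hk := aemeasurable_enorm_kernel a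
  rw [X.ρ_indicator_congr hE measurableSet_Iio hIio, ← ENNReal.coe_ofNat, norm, ← X.smul _ _ hk]
  refine X.mono _ _ (measurable_const.indicator measurableSet_Iio).aemeasurable
    (hk.const_mul _) ?_
  filter_upwards [ae_halfLine_pos] with s hs
  by_cases hsE : s ∈ Iio (halfLine E).toReal
  · have hsa : s < a := hsE.trans_le (ENNReal.toReal_le_of_le_ofReal ha.le hEa)
    rw [indicator_of_mem hsE, Real.enorm_of_nonneg (by positivity), ← ENNReal.ofReal_one,
      ofReal_le_coe_mul_ofReal (by positivity), NNReal.coe_ofNat, mul_one_div,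
      le_div_iff₀ (by positivity)]
    linarith [(div_lt_one ha).2 hsa]
  · rw [indicator_of_notMem hsE]
    exact zero_le

theorem ofReal_W (X : RISpace) (hX : (fun s : ℝ => 1 / (1 + s)) ∈ X.carrier) (ht : 0 < t) :
    ENNReal.ofReal (X.W t) = X.norm (kernel t) :=
  ENNReal.ofReal_toReal (X.norm_kernel_lt_top hX ht).ne

theorem lorentzSpace_subset_R_iff (hφ : QuasiConcave φ) (X : RISpace)
    (hX : (fun s : ℝ => 1 / (1 + s)) ∈ X.carrier) :
    lorentzSpace hφ ⊆ X.R hX ↔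
      ∃ C : ℝ≥0, ∀ t, 0 < t → X.norm (kernel t) ≤ C * ENNReal.ofReal (φ t) := by
  rw [R, lorentzSpace_subset_iff]
  refine exists_congr fun C => forall₂_congr fun t ht => ?_
  rw [← X.ofReal_W hX ht, ofReal_le_coe_mul_ofReal (hφ.pos t ht).le]

theorem R_mono (h : Y.carrier ⊆ X.carrier) (hY : (fun s : ℝ => 1 / (1 + s)) ∈ Y.carrier) :
    Y.R hY ⊆ X.R (h hY) := by
  obtain ⟨C, hC⟩ := exists_ρ_le_mul_of_carrier_subset h
  refine (lorentzSpace_subset_R_iff _ X (h hY)).2 ⟨C, fun t ht => ?_⟩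
  rw [Y.ofReal_W hY ht]
  exact hC _ (aemeasurable_enorm_kernel t)

end RISpace

/-! ### The Hardy operator -/

theorem aemeasurable_hardy {f : ℝ → ℝ} (hf : AEMeasurable f halfLine) :
    AEMeasurable (hardy f) halfLine := by
  let g := hf.mk f
  have hgm : Measurable g := hf.measurable_mk
  have heq : hardy f = fun t => 1 / t * ∫ r, (Ioc 0 t).indicator g r := by
    ext t
    rw [hardy, integral_indicator measurableSet_Ioc]
    congr 1
    exact integral_congr_ae (ae_mono (restrict_Ioc_le_halfLine t) hf.ae_eq_mk)
  have hset : MeasurableSet {p : ℝ × ℝ | 0 < p.2 ∧ p.2 ≤ p.1} :=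
    (measurableSet_lt measurable_const measurable_snd).inter
      (measurableSet_le measurable_snd measurable_fst)
  have hint : StronglyMeasurable fun t : ℝ => ∫ r, (Ioc 0 t).indicator g r :=
    StronglyMeasurable.integral_prod_right' (ν := volume)
      (f := {p : ℝ × ℝ | 0 < p.2 ∧ p.2 ≤ p.1}.indicator fun p => g p.2)
      ((hgm.comp measurable_snd).indicator hset).stronglyMeasurable
  rw [heq]
  exact ((measurable_const.div measurable_id).mul hint.measurable).aemeasurable

/-- The averages `t ↦ |E ∩ (0, t]| / t`, that is, the Hardy operator applied to the indicator
of a set which may have infinite measure or fail to be measurable. -/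
noncomputable def setAverage (E : Set ℝ) (t : ℝ) : ℝ≥0∞ :=
  ENNReal.ofReal (1 / t) * volume.restrict (Ioc 0 t) E

theorem measurable_setAverage (E : Set ℝ) : Measurable (setAverage E) := by
  have hmono : Monotone fun t : ℝ => volume.restrict (Ioc 0 t) E := fun s t hst =>
    Measure.restrict_mono (Ioc_subset_Ioc_right hst) le_rfl E
  exact (measurable_const.div measurable_id).ennreal_ofReal.mul hmono.measurable

theorem setAverage_le (ha : 0 < a) (hE : halfLine E ≤ ENNReal.ofReal a) (ht : 0 < t) :
    setAverage E t ≤ (2 : ℝ≥0) * ‖kernel a t‖ₑ := by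
  have hmin : volume.restrict (Ioc 0 t) E ≤ ENNReal.ofReal (min t a) := by
    rw [ENNReal.ofReal_min]
    refine le_min ((measure_mono (subset_univ _)).trans_eq (by simp)) ?_
    exact (restrict_Ioc_le_halfLine t E).trans hE
  calc setAverage E t ≤ ENNReal.ofReal (1 / t) * ENNReal.ofReal (min t a) := by
        unfold setAverage
        gcongr
    _ ≤ (2 : ℝ≥0) * ‖kernel a t‖ₑ := by
        rw [← ENNReal.ofReal_mul (by positivity), Real.enorm_of_nonneg (by positivity),
          ofReal_le_coe_mul_ofReal (by positivity), NNReal.coe_ofNat, mul_one_div,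
          one_div_mul_eq_div, div_le_div_iff₀ ht (by positivity), mul_one_add]
        have hma : min t a * (t / a) ≤ t := by
          calc min t a * (t / a) ≤ a * (t / a) := by gcongr; exact min_le_right _ _
            _ = t := mul_div_cancel₀ t ha.ne'
        linarith [min_le_left t a]

theorem setAverage_eq_iSup (E : Set ℝ) :
    setAverage E = fun t => ⨆ n : ℕ, setAverage (E ∩ Iic (n : ℝ)) t := by
  ext t
  have hmono : Monotone fun n : ℕ => E ∩ Iic (n : ℝ) := fun m n hmn =>
    inter_subset_inter_right _ (Iic_subset_Iic.2 (by exact_mod_cast hmn))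
  have hE : ⋃ n : ℕ, E ∩ Iic (n : ℝ) = E := by
    rw [← inter_iUnion, show ⋃ n : ℕ, Iic (n : ℝ) = univ from iUnion_eq_univ_iff.2 exists_nat_ge,
      inter_univ]
  simp_rw [setAverage, ← ENNReal.mul_iSup]
  rw [← hmono.measure_iUnion, hE]

theorem enorm_hardy_le {f : ℝ → ℝ} (hf : AEMeasurable f halfLine) (ht : 0 < t) :
    ‖hardy f t‖ₑ ≤ ∑' k : ℤ, 2 ^ k * setAverage {x | (2 : ℝ≥0∞) ^ k < ‖f x‖ₑ} t := by
  have hf' : AEMeasurable f (volume.restrict (Ioc 0 t)) :=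
    hf.mono_measure (restrict_Ioc_le_halfLine t)
  calc ‖hardy f t‖ₑ = ENNReal.ofReal (1 / t) * ‖∫ r in Ioc 0 t, f r‖ₑ := by
        rw [hardy, enorm_mul, Real.enorm_of_nonneg (by positivity)]
    _ ≤ ENNReal.ofReal (1 / t) * ∫⁻ r in Ioc 0 t, dyadicSum ‖f r‖ₑ := by
        gcongr
        exact (enorm_integral_le_lintegral_enorm _).trans
          (lintegral_mono fun r => le_dyadicSum enorm_ne_top)
    _ = ∑' k : ℤ, 2 ^ k * setAverage {x | (2 : ℝ≥0∞) ^ k < ‖f x‖ₑ} t := by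
        rw [lintegral_dyadicSum hf'.enorm, ← ENNReal.tsum_mul_left]
        exact tsum_congr fun k => mul_left_comm _ _ _

theorem ρ_setAverage_le_norm_kernel (X : RISpace) (ha : 0 < a)
    (hE : halfLine E ≤ ENNReal.ofReal a) : X.ρ (setAverage E) ≤ 2 * X.norm (kernel a) := by
  have hk := aemeasurable_enorm_kernel a
  rw [← ENNReal.coe_ofNat, RISpace.norm, ← X.smul _ _ hk]
  refine X.mono _ _ (measurable_setAverage E).aemeasurable (hk.const_mul _) ?_
  filter_upwards [ae_halfLine_pos] with t ht
  exact setAverage_le ha hE ht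

theorem ρ_setAverage_le_of_ne_top (hφ : QuasiConcave φ) (X : RISpace)
    (h : ∀ t, 0 < t → X.norm (kernel t) ≤ C * ENNReal.ofReal (φ t)) (hE : halfLine E ≠ ∞) :
    X.ρ (setAverage E) ≤ 2 * C * hφ.mass (halfLine E) := by
  rcases eq_or_ne (halfLine E) 0 with h0 | h0
  · have hzero : setAverage E =ᵐ[halfLine] 0 := Filter.Eventually.of_forall fun t => by
      rw [setAverage, Measure.absolutelyContinuous_of_le (restrict_Ioc_le_halfLine t) h0, mul_zero,
        Pi.zero_apply]
    rw [(X.eq_zero_iff _ (measurable_setAverage E).aemeasurable).2 hzero]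
    exact zero_le
  · have ha : 0 < (halfLine E).toReal := ENNReal.toReal_pos h0 hE
    rw [← ENNReal.ofReal_toReal hE, hφ.mass_ofReal ha, mul_assoc]
    refine (ρ_setAverage_le_norm_kernel X ha (ENNReal.ofReal_toReal hE).ge).trans ?_
    gcongr
    exact h _ ha

theorem ρ_setAverage_le (hφ : QuasiConcave φ) (X : RISpace)
    (h : ∀ t, 0 < t → X.norm (kernel t) ≤ C * ENNReal.ofReal (φ t)) (E : Set ℝ) :
    X.ρ (setAverage E) ≤ 2 * C * hφ.mass (halfLine E) := by
  rw [setAverage_eq_iSup, X.fatou _ fun n => (measurable_setAverage _).aemeasurable]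
  · refine iSup_le fun n => (ρ_setAverage_le_of_ne_top hφ X h ?_).trans ?_
    · refine ((measure_mono inter_subset_right).trans_lt ?_).ne
      rw [halfLine_Iic]
      exact ENNReal.ofReal_lt_top
    · gcongr
      exact hφ.mass_mono (measure_mono inter_subset_left)
  · refine Filter.Eventually.of_forall fun t m n hmn => ?_
    simp only [setAverage]
    gcongr

/-- The Hardy operator maps `Λ_φ` to `Z` with norm at most `C`. -/
def HardyBoundedWith (hφ : QuasiConcave φ) (C : ℝ≥0) (Z : RISpace) : Prop :=
  ∀ f ∈ lorentzSpace hφ, Z.norm (hardy f) ≤ C * lorentzNorm hφ f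

theorem hardyBounded_iff (hφ : QuasiConcave φ) :
    HardyBounded hφ Z ↔ ∃ C : ℝ≥0, HardyBoundedWith hφ C Z :=
  exists_congr fun _ => ⟨fun h f hf => (h f hf).2, fun h f hf => ⟨⟨aemeasurable_hardy hf.1,
    (h f hf).trans_lt (ENNReal.mul_lt_top ENNReal.coe_lt_top hf.2)⟩, h f hf⟩⟩

theorem hardy_indicator_Iio {s : ℝ} (ha : 0 < a) (hs : 0 < s) :
    hardy ((Iio a).indicator fun _ => 1) s = 1 / s * min s a := by
  rw [hardy, integral_indicator_const _ measurableSet_Iio, ← restrict_Ioo_eq_restrict_Ioc,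
    measureReal_restrict_apply measurableSet_Iio, inter_comm, Ioo_inter_Iio,
    Real.volume_real_Ioo_of_le (le_min hs.le ha.le), sub_zero, smul_eq_mul, mul_one]

theorem kernel_le_hardy_indicator_Iio {s : ℝ} (ha : 0 < a) (hs : 0 < s) :
    kernel a s ≤ hardy ((Iio a).indicator fun _ => 1) s := by
  have hsa : 0 < s / a := div_pos hs ha
  rw [hardy_indicator_Iio ha hs, one_div_mul_eq_div, div_le_div_iff₀ (by positivity) hs, one_mul,
    min_mul_of_nonneg _ _ (by positivity)]
  refine le_min (le_mul_of_one_le_right hs.le (by linarith)) ?_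
  rw [mul_one_add, mul_div_cancel₀ s ha.ne']
  linarith

theorem HardyBoundedWith.norm_kernel_le {hφ : QuasiConcave φ} (h : HardyBoundedWith hφ C Z)
    (ha : 0 < a) : Z.norm (kernel a) ≤ C * ENNReal.ofReal (φ a) := by
  have hmem := indicator_Iio_mem_lorentzSpace hφ ha
  calc Z.norm (kernel a) ≤ Z.norm (hardy ((Iio a).indicator fun _ => 1)) := by
        refine Z.mono _ _ (aemeasurable_enorm_kernel a) (aemeasurable_hardy hmem.1).enorm ?_
        filter_upwards [ae_halfLine_pos] with s hs
        have hk := kernel_le_hardy_indicator_Iio ha hs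
        have hk0 : 0 ≤ kernel a s := by positivity
        rw [Real.enorm_of_nonneg hk0, Real.enorm_of_nonneg (hk0.trans hk)]
        exact ENNReal.ofReal_le_ofReal hk
    _ ≤ C * lorentzNorm hφ ((Iio a).indicator fun _ => 1) := h _ hmem
    _ ≤ C * ENNReal.ofReal (φ a) := by
        gcongr
        exact lorentzNorm_indicator_Iio_le hφ ha

theorem hardyBoundedWith_of_norm_kernel_le (hφ : QuasiConcave φ)
    (h : ∀ t, 0 < t → Z.norm (kernel t) ≤ C * ENNReal.ofReal (φ t)) :
    HardyBoundedWith hφ (4 * C) Z := by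
  intro f hf
  let E (k : ℤ) : Set ℝ := {x | (2 : ℝ≥0∞) ^ k < ‖f x‖ₑ}
  have hE (k : ℤ) : AEMeasurable (setAverage (E k)) halfLine :=
    (measurable_setAverage _).aemeasurable
  have hsmul (k : ℤ) :
      Z.ρ (fun t => 2 ^ k * setAverage (E k) t) = 2 ^ k * Z.ρ (setAverage (E k)) := by
    simpa [ENNReal.coe_zpow] using Z.smul (2 ^ k) (setAverage (E k)) (hE k)
  calc Z.norm (hardy f) ≤ Z.ρ fun t => ∑' k : ℤ, 2 ^ k * setAverage (E k) t := by
        refine Z.mono _ _ (aemeasurable_hardy hf.1).enorm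
          (AEMeasurable.tsum fun k => (hE k).const_mul _) ?_
        filter_upwards [ae_halfLine_pos] with t ht
        exact enorm_hardy_le hf.1 ht
    _ ≤ ∑' k : ℤ, 2 ^ k * Z.ρ (setAverage (E k)) := by
        simp_rw [← hsmul]
        exact Z.ρ_tsum_le fun k => (hE k).const_mul _
    _ ≤ ∑' k : ℤ, 2 * C * (2 ^ k * hφ.mass (halfLine (E k))) := by
        refine ENNReal.tsum_le_tsum fun k => ?_
        rw [mul_left_comm]
        gcongr
        exact ρ_setAverage_le hφ Z h (E k)
    _ ≤ 2 * C * (2 * lorentzNorm hφ f) := by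
        rw [ENNReal.tsum_mul_left]
        gcongr
        exact tsum_mass_distribution_le hφ f
    _ = (4 * C : ℝ≥0) * lorentzNorm hφ f := by
        push_cast
        ring

theorem hardyBounded_iff_subset_R (hφ : QuasiConcave φ) (X : RISpace) :
    HardyBounded hφ X ↔
      ∃ hX : (fun s : ℝ => 1 / (1 + s)) ∈ X.carrier, lorentzSpace hφ ⊆ X.R hX := by
  simp_rw [RISpace.lorentzSpace_subset_R_iff, hardyBounded_iff]
  constructor
  · rintro ⟨C, hC⟩
    refine ⟨?_, C, fun t ht => hC.norm_kernel_le ht⟩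
    rw [← kernel_one]
    exact ⟨(RISpace.measurable_kernel 1).aemeasurable, (hC.norm_kernel_le one_pos).trans_lt
      (ENNReal.mul_lt_top ENNReal.coe_lt_top ENNReal.ofReal_lt_top)⟩
  · rintro ⟨-, C, hC⟩
    exact ⟨4 * C, hardyBoundedWith_of_norm_kernel_le hφ hC⟩

/-! ### The space `L¹ + L^∞` -/

theorem distribution_iSup {F : ℕ → ℝ → ℝ≥0∞}
    (hF : ∀ᵐ x ∂halfLine, Monotone fun n => F n x) (l : ℝ≥0∞) :
    distribution (fun x => ⨆ n, F n x) l = ⨆ n, distribution (F n) l := by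
  have hset : {x | l < ⨆ n, F n x} = ⋃ n, {x | l < F n x} := by
    ext x
    simp [lt_iSup_iff]
  rw [distribution, hset, measure_iUnion_eq_iSup_accumulate]
  refine iSup_congr fun n => measure_congr ?_
  filter_upwards [hF] with x hx
  refine propext ⟨fun h => ?_, fun h => mem_accumulate.2 ⟨n, le_rfl, h⟩⟩
  obtain ⟨m, hmn, hm⟩ := mem_accumulate.1 h
  exact lt_of_lt_of_le hm (hx hmn)

theorem lintegral_tsub_const (hf : AEMeasurable f halfLine) (l : ℝ≥0∞) :
    ∫⁻ x, (f x - l) ∂halfLine =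
      ∫⁻ t in {t | ENNReal.ofReal t < l}ᶜ, distribution f (ENNReal.ofReal t) ∂halfLine := by
  have hA (y : ℝ≥0∞) : MeasurableSet {t | ENNReal.ofReal t < y} :=
    measurableSet_lt ENNReal.measurable_ofReal measurable_const
  unfold distribution
  rw [← lintegral_measure_ofReal_lt_comm hf]
  refine lintegral_congr fun x => ?_
  rw [Measure.restrict_apply (hA _), ← sdiff_eq]
  rcases le_total l (f x) with h | h
  · rcases eq_or_ne l ∞ with rfl | hl
    · simp [sdiff_eq]
    · have hsub : {t | ENNReal.ofReal t < l} ⊆ {t | ENNReal.ofReal t < f x} :=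
        fun t ht => lt_of_lt_of_le ht h
      rw [measure_sdiff hsub (hA l).nullMeasurableSet (by rwa [halfLine_ofReal_lt]),
        halfLine_ofReal_lt, halfLine_ofReal_lt]
  · have hsub : {t | ENNReal.ofReal t < f x} ⊆ {t | ENNReal.ofReal t < l} :=
      fun t ht => lt_of_lt_of_le ht h
    rw [tsub_eq_zero_of_le h, sdiff_eq_empty.2 hsub, measure_empty]

/-- The norm of `L¹ + L^∞`: the best decompositions of a nonnegative `f` are the truncations
`f = min f l + (f - l)₊`. -/
noncomputable def sumNorm (f : ℝ → ℝ≥0∞) : ℝ≥0∞ :=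
  ⨅ l : ℝ≥0∞, l + ∫⁻ x, (f x - l) ∂halfLine

theorem sumNorm_le (f : ℝ → ℝ≥0∞) (l : ℝ≥0∞) : sumNorm f ≤ l + ∫⁻ x, (f x - l) ∂halfLine :=
  iInf_le _ l

-- The infimum over `l` is attained at `l = f^*(1)`.
theorem sumNorm_eq_lintegral_min (hf : AEMeasurable f halfLine) :
    sumNorm f = ∫⁻ t, min 1 (distribution f (ENNReal.ofReal t)) ∂halfLine := by
  have hA (l : ℝ≥0∞) : MeasurableSet {t | ENNReal.ofReal t < l} :=
    measurableSet_lt ENNReal.measurable_ofReal measurable_const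
  have hsplit (l : ℝ≥0∞) : l + ∫⁻ x, (f x - l) ∂halfLine =
      ∫⁻ _ in {t | ENNReal.ofReal t < l}, 1 ∂halfLine +
        ∫⁻ t in {t | ENNReal.ofReal t < l}ᶜ, distribution f (ENNReal.ofReal t) ∂halfLine := by
    rw [lintegral_tsub_const hf, setLIntegral_one, halfLine_ofReal_lt]
  refine le_antisymm ?_ (le_iInf fun l => ?_)
  · let l := sInf {m | distribution f m ≤ 1}
    rw [← lintegral_add_compl _ (hA l)]
    refine (sumNorm_le f l).trans ((hsplit l).trans_le (add_le_add ?_ ?_))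
    · refine setLIntegral_mono' (hA l) fun t ht => le_min le_rfl ?_
      exact ((lt_sInf_distribution_le_iff _ _ _).1 ht).le
    · refine setLIntegral_mono' (hA l).compl fun t ht => le_min ?_ le_rfl
      exact not_lt.1 fun h => ht ((lt_sInf_distribution_le_iff _ _ _).2 h)
  · rw [hsplit, ← lintegral_add_compl _ (hA l)]
    gcongr
    · exact min_le_left _ _
    · exact min_le_right _ _

theorem sumNorm_mono {g : ℝ → ℝ≥0∞} (h : ∀ᵐ x ∂halfLine, f x ≤ g x) : sumNorm f ≤ sumNorm g :=
  iInf_mono fun _ => add_le_add le_rfl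
    (lintegral_mono_ae (h.mono fun _ hx => tsub_le_tsub_right hx _))

theorem setLIntegral_le_sumNorm (f : ℝ → ℝ≥0∞) (hE : halfLine E ≠ ∞) :
    ∫⁻ x in E, f x ∂halfLine ≤ max (halfLine E) 1 * sumNorm f := by
  rw [sumNorm, ENNReal.mul_iInf_of_ne (by simp) (by simp [hE])]
  refine le_iInf fun l => ?_
  calc ∫⁻ x in E, f x ∂halfLine ≤ ∫⁻ x in E, (l + (f x - l)) ∂halfLine :=
        lintegral_mono fun x => le_add_tsub
    _ = halfLine E * l + ∫⁻ x in E, (f x - l) ∂halfLine := by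
        rw [lintegral_add_left measurable_const, setLIntegral_const, mul_comm]
    _ ≤ max (halfLine E) 1 * l + max (halfLine E) 1 * ∫⁻ x, (f x - l) ∂halfLine := by
        gcongr
        · exact le_max_left _ _
        · exact (setLIntegral_le_lintegral _ _).trans (le_mul_of_one_le_left' (le_max_right _ _))
    _ = max (halfLine E) 1 * (l + ∫⁻ x, (f x - l) ∂halfLine) := (mul_add _ _ _).symm

theorem sumNorm_eq_zero_iff (hf : AEMeasurable f halfLine) :
    sumNorm f = 0 ↔ f =ᵐ[halfLine] 0 := by
  refine ⟨fun h => ?_, fun h => le_antisymm ((sumNorm_le f 0).trans ?_) zero_le⟩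
  · refine ae_of_forall_measure_lt_top_ae_restrict _ fun E _ hfin => ?_
    have hE := setLIntegral_le_sumNorm f hfin.ne
    rwa [h, mul_zero, nonpos_iff_eq_zero, lintegral_eq_zero_iff' hf.restrict] at hE
  · simp [lintegral_congr_ae h]

theorem sumNorm_smul (c : ℝ≥0) (hf : AEMeasurable f halfLine) :
    sumNorm (fun x => c * f x) = c * sumNorm f := by
  rcases eq_or_ne c 0 with rfl | hc
  · rw [(sumNorm_eq_zero_iff (hf.const_mul _)).2 (Filter.Eventually.of_forall fun x => by simp)]
    simp
  have hc' : (c : ℝ≥0∞) ≠ 0 := ENNReal.coe_ne_zero.2 hc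
  have hsurj : Function.Surjective fun l : ℝ≥0∞ => c * l := fun l =>
    ⟨(c : ℝ≥0∞)⁻¹ * l, ENNReal.mul_inv_cancel_left hc' ENNReal.coe_ne_top⟩
  rw [sumNorm, sumNorm, ENNReal.mul_iInf_of_ne hc' ENNReal.coe_ne_top, ← hsurj.iInf_comp]
  refine iInf_congr fun l => ?_
  simp_rw [← ENNReal.mul_sub fun _ _ => ENNReal.coe_ne_top]
  rw [lintegral_const_mul' _ _ ENNReal.coe_ne_top, mul_add]

theorem sumNorm_add_le (hf : AEMeasurable f halfLine) (g : ℝ → ℝ≥0∞) :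
    sumNorm (fun x => f x + g x) ≤ sumNorm f + sumNorm g := by
  simp_rw [sumNorm, ENNReal.iInf_add, ENNReal.add_iInf]
  refine le_iInf fun l => le_iInf fun m => (iInf_le _ (l + m)).trans ?_
  have hfl : AEMeasurable (fun x => f x - l) halfLine := hf.sub aemeasurable_const
  rw [add_add_add_comm, ← lintegral_add_left' hfl]
  gcongr
  exact add_tsub_add_le_tsub_add_tsub

theorem sumNorm_iSup {F : ℕ → ℝ → ℝ≥0∞} (hF : ∀ n, AEMeasurable (F n) halfLine)
    (hmono : ∀ᵐ x ∂halfLine, Monotone fun n => F n x) :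
    sumNorm (fun x => ⨆ n, F n x) = ⨆ n, sumNorm (F n) := by
  rw [sumNorm_eq_lintegral_min (AEMeasurable.iSup hF)]
  simp_rw [sumNorm_eq_lintegral_min (hF _), distribution_iSup hmono, inf_iSup_eq]
  refine lintegral_iSup (fun n => ?_) fun m n hmn t => min_le_min_left _ ?_
  · exact measurable_const.min
      ((distribution_anti (F n)).measurable.comp ENNReal.measurable_ofReal)
  · exact measure_mono_ae (hmono.mono fun x hx h => lt_of_lt_of_le h (hx hmn))

/-- The r.i. space `L¹ + L^∞`. -/
noncomputable def sumSpace : RISpace where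
  ρ := sumNorm
  eq_zero_iff _ hf := sumNorm_eq_zero_iff hf
  smul c _ hf := sumNorm_smul c hf
  add_le _ g hf _ := sumNorm_add_le hf g
  mono _ _ _ _ h := sumNorm_mono h
  fatou _ hf hmono := sumNorm_iSup hf hmono
  indicator_lt_top E hE hfin := by
    refine (sumNorm_le _ 0).trans_lt ?_
    simpa [lintegral_indicator_const hE] using hfin
  setLIntegral_le E _ hfin := by
    refine ⟨(max (halfLine E) 1).toNNReal, fun f _ => ?_⟩
    rw [ENNReal.coe_toNNReal (by simp [hfin.ne])]
    exact setLIntegral_le_sumNorm f hfin.ne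
  rearrangement_invariant f g hf hg h := by
    simp_rw [sumNorm_eq_lintegral_min hf, sumNorm_eq_lintegral_min hg, h]

theorem setLIntegral_enorm_kernel (ht : 0 < t) :
    ∫⁻ s in Iic 1, ‖kernel t s‖ₑ ∂halfLine = ENNReal.ofReal (t * Real.log (1 + 1 / t)) := by
  have hcont : ContinuousOn (kernel t) (Icc 0 1) := fun s hs => by
    have : 1 + s / t ≠ 0 := by have := hs.1; positivity
    exact ContinuousAt.continuousWithinAt (by unfold kernel; fun_prop (disch := assumption))
  have hint : IntegrableOn (kernel t) (Ioc 0 1) :=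
    (hcont.integrableOn_Icc).mono_set Ioc_subset_Icc_self
  have hint' : ∫ s in Ioc 0 1, kernel t s = t * Real.log (1 + 1 / t) := by
    rw [← intervalIntegral.integral_of_le zero_le_one]
    simp only [kernel, one_div]
    rw [intervalIntegral.integral_comp_add_div (fun x => x⁻¹) ht.ne',
      integral_inv_of_pos (by simp) (by positivity)]
    simp
  rw [halfLine, Measure.restrict_restrict measurableSet_Iic, inter_comm, Ioi_inter_Iic, ← hint',
    ofReal_integral_eq_lintegral_ofReal hint]
  · refine setLIntegral_congr_fun measurableSet_Ioc fun s hs => ?_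
    have := hs.1
    exact Real.enorm_of_nonneg (by positivity)
  · filter_upwards [ae_restrict_mem measurableSet_Ioc] with s hs
    have := hs.1
    change 0 ≤ kernel t s
    positivity

theorem norm_kernel_sumSpace_le (ht : 0 < t) :
    sumSpace.norm (kernel t) ≤ 2 * ENNReal.ofReal (t * Real.log (1 + 1 / t)) := by
  have hlog : kernel t 1 ≤ t * Real.log (1 + 1 / t) := by
    have h := Real.one_sub_inv_le_log_of_pos (x := 1 + 1 / t) (by positivity)
    calc kernel t 1 = t * (1 - (1 + 1 / t)⁻¹) := by
          unfold kernel
          field_simp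
          ring
      _ ≤ t * Real.log (1 + 1 / t) := by gcongr
  calc sumSpace.norm (kernel t)
      ≤ ‖kernel t 1‖ₑ + ∫⁻ s, (‖kernel t s‖ₑ - ‖kernel t 1‖ₑ) ∂halfLine := sumNorm_le _ _
    _ ≤ ‖kernel t 1‖ₑ + ∫⁻ s in Iic 1, ‖kernel t s‖ₑ ∂halfLine := by
        rw [← lintegral_indicator measurableSet_Iic]
        refine add_le_add le_rfl (lintegral_mono_ae ?_)
        filter_upwards [ae_halfLine_pos] with s hs
        rcases le_or_gt s 1 with hs1 | hs1
        · rw [indicator_of_mem (mem_Iic.2 hs1)]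
          exact tsub_le_self
        · rw [indicator_of_notMem (notMem_Iic.2 hs1), tsub_eq_zero_of_le]
          rw [Real.enorm_of_nonneg (by positivity), Real.enorm_of_nonneg (by positivity)]
          unfold kernel
          gcongr
    _ ≤ 2 * ENNReal.ofReal (t * Real.log (1 + 1 / t)) := by
        rw [setLIntegral_enorm_kernel ht, Real.enorm_of_nonneg (by positivity), two_mul]
        gcongr

theorem hardyBounded_sumSpace (hφ : QuasiConcave φ)
    (h : ∃ C : ℝ, 0 < C ∧ ∀ t : ℝ, 0 < t → C * t * Real.log (1 + 1 / t) ≤ φ t) :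
    HardyBounded hφ sumSpace := by
  obtain ⟨C, hC, hlow⟩ := h
  have hker (t : ℝ) (ht : 0 < t) :
      sumSpace.norm (kernel t) ≤ (2 * C.toNNReal⁻¹ : ℝ≥0) * ENNReal.ofReal (φ t) := by
    refine (norm_kernel_sumSpace_le ht).trans ?_
    rw [ENNReal.coe_mul, mul_assoc, ENNReal.coe_ofNat]
    gcongr
    rw [ofReal_le_coe_mul_ofReal (hφ.pos t ht).le, NNReal.coe_inv, Real.coe_toNNReal _ hC.le,
      le_inv_mul_iff₀ hC, ← mul_assoc]
    exact hlow t ht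
  exact (hardyBounded_iff hφ).2 ⟨_, hardyBoundedWith_of_norm_kernel_le hφ hker⟩

/-! ### The optimal range -/

theorem exists_scale_hardyBoundedWith_one {hφ : QuasiConcave φ} (h : HardyBounded hφ Z) :
    ∃ (c : ℝ≥0) (hc : c ≠ 0), HardyBoundedWith hφ 1 (Z.scale c hc) := by
  obtain ⟨C, hC⟩ := (hardyBounded_iff hφ).1 h
  refine ⟨(C + 1)⁻¹, by positivity, fun f hf => ?_⟩
  calc (((C + 1)⁻¹ : ℝ≥0) : ℝ≥0∞) * Z.norm (hardy f)
      ≤ ((C + 1)⁻¹ : ℝ≥0) * (C * lorentzNorm hφ f) := by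
        gcongr
        exact hC f hf
    _ = ((C + 1)⁻¹ * C : ℝ≥0) * lorentzNorm hφ f := by rw [← mul_assoc, ENNReal.coe_mul]
    _ ≤ (1 : ℝ≥0) * lorentzNorm hφ f := by
        gcongr
        rw [inv_mul_le_iff₀ (by positivity)]
        simp

theorem HardyBoundedWith.ρ_indicator_le {hφ : QuasiConcave φ} (h : HardyBoundedWith hφ C Z)
    (hE : MeasurableSet E) (hfin : halfLine E < ∞) :
    Z.ρ (E.indicator fun _ => 1) ≤
      2 * (C * ENNReal.ofReal (φ ((halfLine E).toReal + 1))) := by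
  have ha : 0 < (halfLine E).toReal + 1 := by positivity
  have hEa : halfLine E ≤ ENNReal.ofReal ((halfLine E).toReal + 1) :=
    (ENNReal.ofReal_toReal hfin.ne).ge.trans (ENNReal.ofReal_le_ofReal (by linarith))
  refine (Z.ρ_indicator_le ha hE hEa).trans ?_
  gcongr
  exact h.norm_kernel_le ha

theorem exists_isOptimalRange (hφ : QuasiConcave φ) (h : HardyBounded hφ Z) :
    ∃ N : RISpace, IsOptimalRange hφ N := by
  let ι := {Y : RISpace // HardyBoundedWith hφ 1 Y}
  obtain ⟨c₀, hc₀, hZ⟩ := exists_scale_hardyBoundedWith_one h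
  have : Nonempty ι := ⟨⟨_, hZ⟩⟩
  let N : RISpace := RISpace.sup (fun Y : ι => Y.1) fun E hE hfin =>
    (iSup_le fun Y => Y.2.ρ_indicator_le hE hfin).trans_lt (by finiteness)
  have hN : HardyBoundedWith hφ 1 N := fun f hf => iSup_le fun Y : ι => Y.2 f hf
  refine ⟨N, (hardyBounded_iff hφ).2 ⟨1, hN⟩, fun Y hY f hf => ⟨hf.1, ?_⟩⟩
  obtain ⟨c, hc, hcY⟩ := exists_scale_hardyBoundedWith_one hY
  have hle : c * Y.norm f ≤ N.norm f :=
    le_iSup (fun i : ι => i.1.ρ fun x => ‖f x‖ₑ) ⟨Y.scale c hc, hcY⟩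
  exact ENNReal.lt_top_of_mul_ne_top_right (hle.trans_lt hf.2).ne (ENNReal.coe_ne_zero.2 hc)

theorem IsOptimalRange.solves {hφ : QuasiConcave φ} (hY : IsOptimalRange hφ Y)
    (hX : X.Solves hφ) : Y.Solves hφ := by
  obtain ⟨hkX, hRX⟩ := hX
  obtain ⟨hkY, hφY⟩ := (hardyBounded_iff_subset_R hφ Y).1 hY.1
  have hYX : Y.carrier ⊆ X.carrier :=
    hY.2 X ((hardyBounded_iff_subset_R hφ X).2 ⟨hkX, hRX.ge⟩)
  exact ⟨hkY, ((RISpace.R_mono hYX hkY).trans hRX.le).antisymm hφY⟩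

end RestrictedType

theorem corollary2p4 (φ : ℝ → ℝ) (hφ : RestrictedType.QuasiConcave φ)
    (h3 : ∃ C : ℝ, 0 < C ∧ ∀ t : ℝ, 0 < t → C * t * Real.log (1 + 1 / t) ≤ φ t) :
    (∃ N : RestrictedType.RISpace, RestrictedType.IsOptimalRange hφ N) ∧
    ∀ N : RestrictedType.RISpace, RestrictedType.IsOptimalRange hφ N →
      ((∃ X : RestrictedType.RISpace, X.Solves hφ) ↔ N.Solves hφ) :=
  ⟨RestrictedType.exists_isOptimalRange hφ (RestrictedType.hardyBounded_sumSpace hφ h3),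
    fun N hN => ⟨fun ⟨_, hX⟩ => hN.solves hX, fun h => ⟨N, h⟩⟩⟩
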